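/- Setting. Let $(\Gamma,d)$ be a $\nu$-regular metric space for some $\nu>0$: with $b_x(r)=\{y: d(x,y)\le r\}$ there is $\kappa$ such that $|b_x(n)|\le\kappa n^\nu$ for all $x\in\Gamma$ and all integers $n\ge 1$. At each $x\in\Gamma$ there is a spin of finite dimension $d_x\ge 1$. For finite $\Lambda\subset\Gamma$ put $\mathcal A_\Lambda=\bigotimes_{x\in\Lambda}M_{d_x}$, let $\mathcal A^{\rm loc}=\bigcup_\Lambda\mathcal A_\Lambda$, and let $\mathcal A$ be its norm completion (the quasi-local $C^*$-algebra). Reference model. Let $R>0$ and let $h_x=h_x^*\in\mathcal A_{b_x(R)}$ ($x\in\Gamma$) satisfy $\sup_x\|h_x\|<\infty$, $h_x\ge 0$, and $\min\operatorname{spec}H_\Lambda=0$ for every finite $\Lambda\subset\Gamma$, where $H_\Lambda=\sum_{x\in\Lambda:\ \operatorname{supp}h_x\subset\Lambda}h_x$. Let $P_\Lambda$ be the orthogonal projection onto $\ker H_\Lambda$. Let $\tau_t$ be the infinite-volume dynamics on $\mathcal A$, i.e. the strongly continuous one-parameter group of automorphisms with $\frac{d}{dt}\tau_t(A)=i\,\tau_t(\delta_0(A))$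 for $A\in\mathcal A^{\rm loc}$, where $\delta_0(A)=\sum_{x\in\Lambda(R)}[h_x,A]$ for $A\in\mathcal A_\Lambda$ and $\Lambda(R)=\bigcup_{x\in\Lambda}b_x(R)$. Let $\omega$ be a zero-energy ground state, i.e. a state on $\mathcal A$ with $\omega(h_x)=0$ for all $x$, let $(\mathcal H,\pi,\Omega)$ be its GNS triple, and let $H_0$ be the GNS Hamiltonian: the non-negative self-adjoint operator on $\mathcal H$ with $H_0\Omega=0$ and $\pi(\tau_t(A))=e^{itH_0}\pi(A)e^{-itH_0}$ for all $A\in\mathcal A$, $t\in\mathbb R$. Local gaps and separating partitions. Let $\Lambda(x,n)\subset\Gamma$ ($x\in\Gamma$, $n\ge 0$) be finite sets with $b_x(n)\subset\Lambda(x,n)$, let $c,\zeta>0$, and for each integer $n\ge 1$ let $\mathcal T_n$ be a partition of $\Gamma$ into at most $c\,n^\zeta$ parts such that $\Lambda(x,n)\cap\Lambda(y,n)=\emptyset$ whenever $x\ne y$ lie in the same part of $\mathcal T_n$. Let $\gamma(n)>0$ (integers $n\ge R$) be such that $\operatorname{spec}(H_{\Lambda(x,n)})\subset\{0\}\cup[\gamma(n),\infty)$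 for all $x\in\Gamma$ and $n\ge R$. Theorem. Let $\Phi(x,n)=\Phi(x,n)^*\in\mathcal A_{b_x(n)}$ ($x\in\Gamma$, integers $n\ge R$) satisfy $\sum_{x\in\Gamma}\sum_{n\ge R}\|\Phi(x,n)\|<\infty$ and $$\Phi(x,n)P_{b_x(n)}=P_{b_x(n)}\Phi(x,n)=0\quad\text{for all }x\in\Gamma,\ n\ge R,$$ and let $G(n)\ge 0$ be numbers with $\|\Phi(x,n)\|\le G(n)$ for all $x\in\Gamma$ and $n\ge R$. Put $$V=\sum_{x\in\Gamma}\sum_{n\ge R}\Phi(x,n)\in\mathcal A,\qquad \beta=c\sum_{n\ge R}\frac{n^\zeta G(n)}{\gamma(n)}\in[0,\infty].$$ Then, with the convention $\infty\cdot 0=0$, $$|\langle\psi,\pi(V)\psi\rangle|\le\beta\,\langle\psi,H_0\psi\rangle\qquad\text{for all }\psi\in\operatorname{dom}H_0.$$ -/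

import Mathlib

open scoped ComplexOrder InnerProductSpace ENNReal

noncomputable section

namespace QSpin

/-! ### Configurations and the matrix algebras of finite volumes -/

section LocalAlgebras

variable {Γ : Type*} (d : Γ → ℕ+)

/-- Classical spin configurations on `Γ`: at the site `x` the basis vectors of `ℂ ^ (d x)` are
labelled by `Fin (d x)`. -/
abbrev Cfg : Type _ := ∀ x : Γ, Fin (d x)

/-- Configurations on a finite volume `Λ`. They label the product basis of `⨂_{x ∈ Λ} ℂ ^ (d x)`,
so that `Matrix (LocalCfg d Λ) (LocalCfg d Λ) ℂ` is the algebra `⨂_{x ∈ Λ} M_{d x}`. -/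
def LocalCfg (Λ : Finset Γ) : Type _ := ∀ x : Λ, Fin (d x)

open Classical in
instance (Λ : Finset Γ) : Fintype (LocalCfg d Λ) :=
  inferInstanceAs (Fintype (∀ x : Λ, Fin (d x)))

instance (Λ : Finset Γ) : DecidableEq (LocalCfg d Λ) := Classical.decEq _

variable {d}

/-- Restriction of a configuration to `Λ`. -/
def res (Λ : Finset Γ) (σ : Cfg d) : LocalCfg d Λ := fun x => σ x

open Classical in
/-- The configuration that equals `t` on `Λ` and `σ` off `Λ`. -/
def splice (Λ : Finset Γ) (σ : Cfg d) (t : LocalCfg d Λ) : Cfg d :=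
  fun x => if hx : x ∈ Λ then t ⟨x, hx⟩ else σ x

@[simp] lemma res_splice (Λ : Finset Γ) (σ : Cfg d) (t : LocalCfg d Λ) :
    res Λ (splice Λ σ t) = t := by
  funext x
  simp [res, splice]

@[simp] lemma splice_splice (Λ : Finset Γ) (σ : Cfg d) (s t : LocalCfg d Λ) :
    splice Λ (splice Λ σ s) t = splice Λ σ t := by
  funext x
  by_cases hx : x ∈ Λ <;> simp [splice, hx]

@[simp] lemma splice_res (Λ : Finset Γ) (σ : Cfg d) : splice Λ σ (res Λ σ) = σ := by
  funext x
  by_cases hx : x ∈ Λ <;> simp [splice, res, hx]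

lemma splice_of_res {Λ : Finset Γ} {σ : Cfg d} {t : LocalCfg d Λ} (h : res Λ σ = t) :
    splice Λ σ t = σ := by
  rw [← h, splice_res]

variable (d) in
/-- The Hilbert space `ℓ²` over all configurations of `Γ`; the algebra of quasi-local observables
is realized as operators on it. -/
abbrev CfgSpace : Type _ := lp (fun _ : Cfg d => ℂ) 2

lemma sum_unit_le (Λ : Finset Γ) (s t : LocalCfg d Λ) (ψ : CfgSpace d) (F : Finset (Cfg d)) :
    ∑ σ ∈ F, ‖(if res Λ σ = s then ψ (splice Λ σ t) else 0 : ℂ)‖ ^ (2 : ℝ≥0∞).toReal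
      ≤ ‖ψ‖ ^ (2 : ℝ≥0∞).toReal := by
  classical
  have hinj : Set.InjOn (fun σ : Cfg d => splice Λ σ t) (F.filter fun σ => res Λ σ = s) := by
    intro σ hσ σ' hσ' h
    have h1 : res Λ σ = s := by simpa using (Finset.mem_filter.1 hσ).2
    have h2 : res Λ σ' = s := by simpa using (Finset.mem_filter.1 hσ').2
    have := congrArg (fun ρ => splice Λ ρ s) h
    simp only [splice_splice] at this
    rw [← h1] at this
    rw [splice_res, h1, ← h2, splice_res] at this
    exact this
  calc ∑ σ ∈ F, ‖(if res Λ σ = s then ψ (splice Λ σ t) else 0 : ℂ)‖ ^ (2 : ℝ≥0∞).toReal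
      = ∑ σ ∈ F.filter (fun σ => res Λ σ = s),
          ‖ψ (splice Λ σ t)‖ ^ (2 : ℝ≥0∞).toReal := by
        rw [Finset.sum_filter]
        refine Finset.sum_congr rfl fun σ _ => ?_
        split_ifs <;> simp
    _ = ∑ ρ ∈ (F.filter (fun σ => res Λ σ = s)).image (fun σ => splice Λ σ t),
          ‖ψ ρ‖ ^ (2 : ℝ≥0∞).toReal := by rw [Finset.sum_image hinj]
    _ ≤ _ := lp.sum_rpow_le_norm_rpow (by simp) ψ _

/-- The matrix unit `|s⟩⟨t|` of the volume `Λ`, tensored with the identity off `Λ`. -/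
def unitOp (Λ : Finset Γ) (s t : LocalCfg d Λ) : CfgSpace d →L[ℂ] CfgSpace d :=
  LinearMap.mkContinuous
    { toFun := fun ψ => ⟨fun σ => if res Λ σ = s then ψ (splice Λ σ t) else 0,
        memℓp_gen' (sum_unit_le Λ s t ψ)⟩
      map_add' := by
        intro ψ φ
        ext σ
        change (if _ then _ else _ : ℂ) = (if _ then _ else _) + (if _ then _ else _)
        split_ifs <;> simp
      map_smul' := by
        intro a ψ
        ext σ
        change (if _ then _ else _ : ℂ) = a • (if _ then _ else _ : ℂ)
        split_ifs <;> simp } 1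
    (fun ψ => by
      rw [one_mul]
      exact lp.norm_le_of_forall_sum_le (by simp) (norm_nonneg _) (sum_unit_le Λ s t ψ))

lemma unitOp_apply (Λ : Finset Γ) (s t : LocalCfg d Λ) (ψ : CfgSpace d) (σ : Cfg d) :
    unitOp Λ s t ψ σ = if res Λ σ = s then ψ (splice Λ σ t) else 0 := rfl

lemma unitOp_mul (Λ : Finset Γ) (s t u v : LocalCfg d Λ) :
    unitOp Λ s t * unitOp Λ u v = if t = u then unitOp Λ s v else 0 := by
  ext ψ σ
  change (if _ then (if res Λ (splice Λ σ t) = u then _ else _) else _ : ℂ) = _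
  rw [res_splice, splice_splice]
  by_cases h : t = u
  · simp [h, unitOp_apply]
  · simp [h]

lemma star_unitOp (Λ : Finset Γ) (s t : LocalCfg d Λ) :
    star (unitOp Λ s t) = unitOp Λ t s := by
  rw [ContinuousLinearMap.star_eq_adjoint, eq_comm, ContinuousLinearMap.eq_adjoint_iff]
  intro ψ φ
  rw [lp.inner_eq_tsum, lp.inner_eq_tsum]
  simp only [unitOp_apply]
  let e : {σ : Cfg d // res Λ σ = t} ≃ {σ : Cfg d // res Λ σ = s} :=
    { toFun := fun σ => ⟨splice Λ σ s, by simp⟩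
      invFun := fun σ => ⟨splice Λ σ t, by simp⟩
      left_inv := fun σ => by
        ext1
        simp only [splice_splice]
        exact splice_of_res σ.2
      right_inv := fun σ => by
        ext1
        simp only [splice_splice]
        exact splice_of_res σ.2 }
  have h1 : (∑' σ : Cfg d, ⟪(if res Λ σ = t then ψ (splice Λ σ s) else 0 : ℂ), φ σ⟫_ℂ)
      = ∑' σ : {σ : Cfg d // res Λ σ = t}, ⟪ψ (splice Λ σ s), φ σ⟫_ℂ := by
    refine Eq.trans (tsum_congr fun σ => ?_)
      (tsum_subtype {σ : Cfg d | res Λ σ = t} (fun σ => ⟪ψ (splice Λ σ s), φ σ⟫_ℂ)).symm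
    by_cases h : res Λ σ = t <;> simp [Set.indicator, h]
  have h2 : (∑' σ : Cfg d, ⟪ψ σ, (if res Λ σ = s then φ (splice Λ σ t) else 0 : ℂ)⟫_ℂ)
      = ∑' σ : {σ : Cfg d // res Λ σ = s}, ⟪ψ σ, φ (splice Λ σ t)⟫_ℂ := by
    refine Eq.trans (tsum_congr fun σ => ?_)
      (tsum_subtype {σ : Cfg d | res Λ σ = s} (fun σ => ⟪ψ σ, φ (splice Λ σ t)⟫_ℂ)).symm
    by_cases h : res Λ σ = s <;> simp [Set.indicator, h]
  refine h1.trans (Eq.trans ?_ h2.symm)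
  rw [← e.tsum_eq]
  refine tsum_congr fun σ => ?_
  have : splice Λ (e σ : Cfg d) t = σ := congrArg Subtype.val (e.left_inv σ)
  rw [this]
  rfl

/-- The embedding `a ↦ a ⊗ 1` of the matrix algebra of the volume `Λ` into the bounded operators
on `CfgSpace d`. -/
def matrixEmb (Λ : Finset Γ) :
    Matrix (LocalCfg d Λ) (LocalCfg d Λ) ℂ →⋆ₐ[ℂ] (CfgSpace d →L[ℂ] CfgSpace d) :=
  { AlgHom.ofLinearMap
      ({ toFun := fun a => ∑ s, ∑ t, a s t • unitOp Λ s t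
         map_add' := by
           intro a b
           simp [add_smul, Finset.sum_add_distrib]
         map_smul' := by
           intro z a
           simp [Finset.smul_sum, mul_smul] } :
        Matrix (LocalCfg d Λ) (LocalCfg d Λ) ℂ →ₗ[ℂ] (CfgSpace d →L[ℂ] CfgSpace d))
      (by
        ext ψ σ
        simp only [LinearMap.coe_mk, AddHom.coe_mk, Matrix.one_apply, ite_smul, one_smul,
          zero_smul, Finset.sum_ite_eq, Finset.mem_univ, if_true]
        simp only [sum_apply, lp.coeFn_sum, Finset.sum_apply, unitOp_apply]
        simp)
      (by
        intro a b
        simp only [LinearMap.coe_mk, AddHom.coe_mk]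
        symm
        calc (∑ s, ∑ t, a s t • unitOp Λ s t) * (∑ u, ∑ v, b u v • unitOp Λ u v)
            = ∑ s, ∑ t, ∑ u, ∑ v, (a s t * b u v) • (unitOp Λ s t * unitOp Λ u v) := by
              simp only [Finset.sum_mul]
              simp only [Finset.mul_sum, smul_mul_smul_comm]
          _ = ∑ s, ∑ t, ∑ v, (a s t * b t v) • unitOp Λ s v := by
              refine Finset.sum_congr rfl fun s _ => Finset.sum_congr rfl fun t _ => ?_
              rw [Finset.sum_comm]
              simp [unitOp_mul]
          _ = _ := by
              refine Finset.sum_congr rfl fun s _ => ?_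
              rw [Finset.sum_comm]
              simp only [Matrix.mul_apply, Finset.sum_smul]) with
    map_star' := by
      intro a
      change ∑ s, ∑ t, (star a) s t • unitOp Λ s t = star (∑ s, ∑ t, a s t • unitOp Λ s t)
      simp only [star_sum, star_smul, star_unitOp, Matrix.star_apply]
      exact Finset.sum_comm }

/-- The matrix `a` acts on the sites of `Λ` and leaves the other sites alone. -/
lemma matrixEmb_apply (Λ : Finset Γ) (a : Matrix (LocalCfg d Λ) (LocalCfg d Λ) ℂ)
    (ψ : CfgSpace d) (σ : Cfg d) :
    matrixEmb Λ a ψ σ = ∑ t, a (res Λ σ) t * ψ (splice Λ σ t) := by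
  change (∑ s, ∑ t, a s t • unitOp Λ s t) ψ σ = _
  simp only [sum_apply, lp.coeFn_sum, Finset.sum_apply,
    smul_apply, lp.coeFn_smul, Pi.smul_apply, unitOp_apply, smul_eq_mul,
    mul_ite, mul_zero]
  rw [Finset.sum_comm]
  simp

variable (d)

/-- The C⋆-algebra of quasi-local observables: the norm closure of the union of the (embedded)
matrix algebras of all finite volumes. -/
def quasiLocal : StarSubalgebra ℂ (CfgSpace d →L[ℂ] CfgSpace d) :=
  (⨆ Λ : Finset Γ, (matrixEmb (d := d) Λ).range).topologicalClosure

/-- The quasi-local algebra as a type. -/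
abbrev Obs : Type _ := quasiLocal d

instance : IsClosed (quasiLocal d : Set (CfgSpace d →L[ℂ] CfgSpace d)) :=
  StarSubalgebra.isClosed_topologicalClosure _

/-- The subalgebra `𝒜_Λ` of observables localized in the finite volume `Λ`. For finite `Λ`, the
inclusion `supp A ⊆ Λ` means exactly that `A ∈ localAlg d Λ`. -/
def localAlg (Λ : Finset Γ) : StarSubalgebra ℂ (Obs d) :=
  (matrixEmb (d := d) Λ).range.comap (quasiLocal d).subtype

end LocalAlgebras

/-! ### Finite-range frustration-free models -/

section Models

variable {Γ : Type*} [MetricSpace Γ] {d : Γ → ℕ+}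

/-- `ν`-regularity: balls are finite and `|b_x(n)| ≤ κ n ^ ν` for `n ≥ 1`. -/
def IsRegularSpace (Γ : Type*) [MetricSpace Γ] (κ ν : ℝ) : Prop :=
  ∀ (x : Γ) (n : ℕ), 1 ≤ n →
    (Metric.closedBall x (n : ℝ)).Finite ∧ ((Metric.closedBall x (n : ℝ)).ncard : ℝ) ≤ κ * n ^ ν

open Classical in
/-- The ball `b_x(r) = {y | d(x, y) ≤ r}` as a finite set (balls of `ν`-regular spaces are
finite). -/
def ball (x : Γ) (r : ℝ) : Finset Γ :=
  if hf : (Metric.closedBall x r).Finite then hf.toFinset else ∅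

open Classical in
/-- `Λ(r) = ⋃_{x ∈ Λ} b_x(r)`. -/
def thicken (Λ : Finset Γ) (r : ℝ) : Finset Γ := Λ.biUnion fun x => ball x r

open Classical in
/-- `H_Λ`, the sum of the terms `h_x` with `x ∈ Λ` and `supp h_x ⊆ Λ`. -/
def localHam (h : Γ → Obs d) (Λ : Finset Γ) : Obs d :=
  ∑ x ∈ Λ with h x ∈ localAlg d Λ, h x

/-- `P_Λ`, the orthogonal projection onto the kernel of `H_Λ`. Here `H_Λ` acts on `CfgSpace d` as
`H_Λ ⊗ 1`, so that this is the ground state projection on `⨂_{x ∈ Λ} ℂ ^ (d x)` tensored with the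
identity off `Λ`. -/
def groundProj (h : Γ → Obs d) (Λ : Finset Γ) : CfgSpace d →L[ℂ] CfgSpace d :=
  (localHam h Λ : CfgSpace d →L[ℂ] CfgSpace d).ker.starProjection

/-- Finite-range, uniformly bounded, frustration-free interactions of interaction radius `R`. -/
structure IsFrustrationFree (R : ℝ) (h : Γ → Obs d) : Prop where
  selfAdjoint : ∀ x, IsSelfAdjoint (h x)
  range : ∀ x, h x ∈ localAlg d (ball x R)
  bounded : BddAbove (Set.range fun x => ‖h x‖)
  nonneg : ∀ x, (h x : CfgSpace d →L[ℂ] CfgSpace d).IsPositive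
  min_spec : ∀ Λ : Finset Γ, IsLeast (spectrum ℝ (localHam h Λ)) 0

/-- `δ₀(A) = ∑_{x ∈ Λ(R)} [h_x, A]` for `A ∈ 𝒜_Λ`. -/
def deriv₀ (R : ℝ) (h : Γ → Obs d) (Λ : Finset Γ) (A : Obs d) : Obs d :=
  ∑ x ∈ thicken Λ R, (h x * A - A * h x)

/-- `τ` is the infinite-volume dynamics of the model: a strongly continuous one-parameter group of
automorphisms with `d/dt τ_t(A) = i τ_t(δ₀(A))` for all local observables `A`. -/
structure IsDynamics (R : ℝ) (h : Γ → Obs d) (τ : ℝ → Obs d ≃⋆ₐ[ℂ] Obs d) : Prop where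
  map_zero : ∀ A, τ 0 A = A
  map_add : ∀ s t A, τ (s + t) A = τ s (τ t A)
  continuous : ∀ A, Continuous fun t => τ t A
  hasDerivAt : ∀ (Λ : Finset Γ), ∀ A ∈ localAlg d Λ, ∀ t : ℝ,
    HasDerivAt (fun t => τ t A) (Complex.I • τ t (deriv₀ R h Λ A)) t

/-- `ω` is a state. -/
structure IsState (ω : Obs d →ₗ[ℂ] ℂ) : Prop where
  map_one : ω 1 = 1
  nonneg : ∀ A, 0 ≤ ω (star A * A)

/-- `ω` is a zero-energy ground state of the interaction `h`. -/
structure IsZeroEnergyState (h : Γ → Obs d) (ω : Obs d →ₗ[ℂ] ℂ) : Prop extends IsState ω where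
  zero_energy : ∀ x, ω (h x) = 0

/-- The family of finite volumes `S x n = Λ(x, n)` contains the balls `b_x(n)`, and the partitions
`T n` of `Γ` (`n ≥ 1`) separate it and are of `(c, ζ)`-polynomial growth. -/
structure IsSeparatingFamily (S : Γ → ℕ → Finset Γ) (T : ℕ → Set (Set Γ)) (c ζ : ℝ) : Prop where
  c_pos : 0 < c
  ζ_pos : 0 < ζ
  ball_subset : ∀ (x : Γ) (n : ℕ), ball x (n : ℝ) ⊆ S x n
  partition : ∀ n, 1 ≤ n → Setoid.IsPartition (T n)
  finite : ∀ n, 1 ≤ n → (T n).Finite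
  growth : ∀ n, 1 ≤ n → ((T n).ncard : ℝ) ≤ c * (n : ℝ) ^ ζ
  separates : ∀ n, 1 ≤ n → ∀ t ∈ T n, ∀ x ∈ t, ∀ y ∈ t, x ≠ y → Disjoint (S x n) (S y n)

end Models

/-! ### The GNS representation and the GNS Hamiltonian -/

section GNS

variable {Γ : Type*} {d : Γ → ℕ+}
  {E : Type*} [NormedAddCommGroup E] [InnerProductSpace ℂ E] [CompleteSpace E]

/-- `(E, π, Ω)` is the GNS triple of `ω`. -/
structure IsGNSTriple (ω : Obs d →ₗ[ℂ] ℂ) (π : Obs d →⋆ₐ[ℂ] (E →L[ℂ] E)) (Ω : E) : Prop where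
  norm_eq_one : ‖Ω‖ = 1
  apply_eq : ∀ A, ω A = ⟪Ω, π A Ω⟫_ℂ
  dense : Dense {ψ : E | ∃ Λ : Finset Γ, ∃ A ∈ localAlg d Λ, ψ = π A Ω}

/-- `U t = exp (i t H)` for a self-adjoint operator `H`: `U` is the strongly continuous
one-parameter unitary group whose generator is `H` (with its full domain). -/
structure IsExpGroup (H : E →ₗ.[ℂ] E) (U : ℝ → E →L[ℂ] E) : Prop where
  map_zero : U 0 = 1
  map_add : ∀ s t, U (s + t) = U s * U t
  unitary : ∀ t, U t ∈ unitary (E →L[ℂ] E)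
  continuous : ∀ ψ, Continuous fun t => U t ψ
  generator : ∀ ψ φ : E,
    (ψ, φ) ∈ H.graph ↔ HasDerivAt (fun t => U t ψ) (Complex.I • φ) 0

/-- `H` is the GNS Hamiltonian: the non-negative self-adjoint operator with `H Ω = 0` that
implements the dynamics, `π(τ_t(A)) = exp(itH) π(A) exp(-itH)`. -/
structure IsGNSHamiltonian (τ : ℝ → Obs d ≃⋆ₐ[ℂ] Obs d) (π : Obs d →⋆ₐ[ℂ] (E →L[ℂ] E)) (Ω : E)
    (H : E →ₗ.[ℂ] E) : Prop where
  selfAdjoint : IsSelfAdjoint H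
  nonneg : ∀ ψ : H.domain, 0 ≤ ⟪(ψ : E), H ψ⟫_ℂ
  vacuum : (Ω, (0 : E)) ∈ H.graph
  implements : ∃ U : ℝ → E →L[ℂ] E, IsExpGroup H U ∧ ∀ t A, π (τ t A) = U t * π A * U (-t)

end GNS

end QSpin

end

noncomputable section

namespace QSpin

/-! ### Local algebras: monotonicity and locality -/

section Locality

variable {Γ : Type*} {d : Γ → ℕ+}

/-! Fix `n`. Since the terms `h x` are positive, a vector of zero energy in `Λ(x,n)` is annihilated
by each term of `H_{Λ(x,n)}`. Hence it lies in the kernel of `H_{b_x(n)}` and is killed by `Φ(x,n)`.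
With the gap this gives the operator inequality `±Φ(x,n) ≤ (G(n)/γ(n)) H_{Λ(x,n)}`, which every
representation preserves (`IsFrustrationFree.norm_inner_le_of_annihilates`). The volumes `Λ(x,n)`
belonging to one part of the partition are disjoint, so their Hamiltonians add up to at most a
finite sum of `h y`. That sum is at most `H₀` as a form (`IsGNSHamiltonian.re_inner_sum_le`).
Summing over the at most `c n^ζ` parts, and then over `n`, produces `β`.

The analytic core is the form bound `∑_{y ∈ Y} π(h y) ≤ H₀`. On local vectors it is algebra: `π(h
y)Ω = 0` turns `H₀ π(A)Ω = π(δ₀ A)Ω` into `∑ π(h y) π(A)Ω`. To reach all of `dom H₀`, local vectors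
must form a core. A vector orthogonal to the image of the local vectors under `H₀ + i` defines a
bounded functional `f` with `f ∘ δ₀ = -i f` on local observables. Then `f(τ_t A) = e^t f(A)` along a
sequence of times tending to infinity, which contradicts boundedness unless `f(A) = 0`
(`IsDynamics.apply_eq_zero`). Because `τ_t A` is no longer local, this growth law is proved by
iterating commutators over short time steps (`norm_le_of_hasDerivAt_commutators`). -/

lemma res_splice_of_disjoint {Λ Λ' : Finset Γ} (hd : Disjoint Λ Λ') (σ : Cfg d)
    (t : LocalCfg d Λ') : res Λ (splice Λ' σ t) = res Λ σ := by
  funext x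
  simp [res, splice, Finset.disjoint_left.1 hd x.2]

lemma splice_comm {Λ Λ' : Finset Γ} (hd : Disjoint Λ Λ') (σ : Cfg d) (s : LocalCfg d Λ)
    (t : LocalCfg d Λ') : splice Λ (splice Λ' σ t) s = splice Λ' (splice Λ σ s) t := by
  funext x
  by_cases hx : x ∈ Λ
  · simp [splice, hx, Finset.disjoint_left.1 hd hx]
  · simp [splice, hx]

lemma unitOp_commute {Λ Λ' : Finset Γ} (hd : Disjoint Λ Λ') (s t : LocalCfg d Λ)
    (u v : LocalCfg d Λ') : Commute (unitOp Λ s t) (unitOp Λ' u v) := by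
  ext ψ σ
  change unitOp Λ s t (unitOp Λ' u v ψ) σ = unitOp Λ' u v (unitOp Λ s t ψ) σ
  simp only [unitOp_apply, res_splice_of_disjoint hd, res_splice_of_disjoint hd.symm,
    splice_comm hd]
  split_ifs <;> rfl

lemma matrixEmb_eq_sum (Λ : Finset Γ) (a : Matrix (LocalCfg d Λ) (LocalCfg d Λ) ℂ) :
    matrixEmb Λ a = ∑ s, ∑ t, a s t • unitOp Λ s t := rfl

lemma matrixEmb_commute {Λ Λ' : Finset Γ} (hd : Disjoint Λ Λ')
    (a : Matrix (LocalCfg d Λ) (LocalCfg d Λ) ℂ) (b : Matrix (LocalCfg d Λ') (LocalCfg d Λ') ℂ) :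
    Commute (matrixEmb Λ a) (matrixEmb Λ' b) := by
  rw [matrixEmb_eq_sum, matrixEmb_eq_sum]
  refine Commute.sum_left _ _ _ fun s _ => Commute.sum_left _ _ _ fun t _ =>
    Commute.sum_right _ _ _ fun u _ => Commute.sum_right _ _ _ fun v _ => ?_
  exact ((unitOp_commute hd s t u v).smul_left _).smul_right _

lemma mem_localAlg {Λ : Finset Γ} {A : Obs d} :
    A ∈ localAlg d Λ ↔ ∃ a, matrixEmb Λ a = (A : CfgSpace d →L[ℂ] CfgSpace d) := Iff.rfl

lemma localAlg_commute {Λ Λ' : Finset Γ} (hd : Disjoint Λ Λ') {A B : Obs d}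
    (hA : A ∈ localAlg d Λ) (hB : B ∈ localAlg d Λ') : A * B = B * A := by
  obtain ⟨a, ha⟩ := mem_localAlg.1 hA
  obtain ⟨b, hb⟩ := mem_localAlg.1 hB
  apply Subtype.ext
  change (A : CfgSpace d →L[ℂ] CfgSpace d) * B = B * A
  rw [← ha, ← hb]
  exact matrixEmb_commute hd a b

/-- The restriction of a configuration on `Λ'` to a smaller volume `Λ`. -/
def subRes {Λ Λ' : Finset Γ} (hs : Λ ⊆ Λ') (t : LocalCfg d Λ') : LocalCfg d Λ :=
  fun x => t ⟨x, hs x.2⟩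

/-- The identity on `Λ' \ Λ` is resolved into diagonal matrix units, one summand for each extension
`u` of `s`. The all-zero configuration is an arbitrary background that `res Λ'` forgets. -/
lemma unitOp_eq_sum {Λ Λ' : Finset Γ} (hs : Λ ⊆ Λ') (s t : LocalCfg d Λ) :
    unitOp Λ s t = ∑ u : LocalCfg d Λ' with subRes hs u = s,
      unitOp Λ' u (res Λ' (splice Λ (splice Λ' (fun x => ⟨0, (d x).pos⟩) u) t)) := by
  ext ψ σ
  simp only [sum_apply, lp.coeFn_sum, Finset.sum_apply, unitOp_apply]
  rw [Finset.sum_ite_eq]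
  simp only [Finset.mem_filter, Finset.mem_univ, true_and]
  change (if res Λ σ = s then _ else _) = if res Λ σ = s then _ else _
  congr 2
  refine congrArg ψ (funext fun x => ?_)
  by_cases hx' : x ∈ Λ'
  · by_cases hx : x ∈ Λ <;> simp [splice, res, hx, hx']
  · have hx : x ∉ Λ := fun h => hx' (hs h)
    simp [splice, hx, hx']

lemma unitOp_mem_range (Λ : Finset Γ) (s t : LocalCfg d Λ) :
    unitOp Λ s t ∈ (matrixEmb (d := d) Λ).range := by
  refine ⟨Matrix.single s t 1, ?_⟩
  change matrixEmb Λ (Matrix.single s t 1) = _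
  rw [matrixEmb_eq_sum, Finset.sum_eq_single s, Finset.sum_eq_single t]
  · simp
  · intro b _ hb
    simp [hb.symm]
  · simp
  · intro b _ hb
    simp [hb.symm]
  · simp

lemma localAlg_mono {Λ Λ' : Finset Γ} (hs : Λ ⊆ Λ') : localAlg d Λ ≤ localAlg d Λ' := by
  intro A hA
  obtain ⟨a, ha⟩ := mem_localAlg.1 hA
  change (A : CfgSpace d →L[ℂ] CfgSpace d) ∈ (matrixEmb (d := d) Λ').range
  rw [← ha, matrixEmb_eq_sum]
  refine sum_mem fun s _ => sum_mem fun t _ => SMulMemClass.smul_mem _ ?_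
  rw [unitOp_eq_sum hs]
  exact sum_mem fun u _ => unitOp_mem_range _ _ _

end Locality

/-! ### Positivity in the quasi-local algebra -/

section Positivity

variable {Γ : Type*} {d : Γ → ℕ+}

lemma exists_star_mul_self_of_spectrum_nonneg {A : Type*} [CStarAlgebra A] {a : A}
    (ha : IsSelfAdjoint a) (hs : ∀ x ∈ spectrum ℝ a, 0 ≤ x) : ∃ b : A, a = star b * b := by
  let _ := CStarAlgebra.spectralOrder A
  have := CStarAlgebra.spectralOrderedRing A
  exact CStarAlgebra.nonneg_iff_eq_star_mul_self.1
    ((StarOrderedRing.nonneg_iff_spectrum_nonneg a ha).2 hs)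

/-- Spectral permanence for C⋆-subalgebras. It allows positivity, known for operators on `CfgSpace
d`, to be used inside the quasi-local algebra. -/
lemma spectrum_coe (A : Obs d) :
    spectrum ℝ (A : CfgSpace d →L[ℂ] CfgSpace d) = spectrum ℝ A := by
  rw [← spectrum.preimage_algebraMap (R := ℝ) (S := ℂ) (a := A),
    ← spectrum.preimage_algebraMap (R := ℝ) (S := ℂ), StarSubalgebra.spectrum_eq]

lemma isSelfAdjoint_coe {A : Obs d} :
    IsSelfAdjoint (A : CfgSpace d →L[ℂ] CfgSpace d) ↔ IsSelfAdjoint A :=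
  ⟨fun h => Subtype.ext h, fun h => congrArg Subtype.val h⟩

/-- A positive operator of the quasi-local algebra is of the form `B⋆ B` within the algebra. -/
lemma exists_star_mul_self {A : Obs d} (hA : (A : CfgSpace d →L[ℂ] CfgSpace d).IsPositive) :
    ∃ B : Obs d, A = star B * B := by
  have h0 := (ContinuousLinearMap.nonneg_iff_isPositive _).2 hA
  refine exists_star_mul_self_of_spectrum_nonneg
    (isSelfAdjoint_coe.1 hA.isSelfAdjoint) fun x hx => ?_
  exact spectrum_nonneg_of_nonneg h0 (spectrum_coe A ▸ hx)

variable {E : Type*} [NormedAddCommGroup E] [InnerProductSpace ℂ E] [CompleteSpace E]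

lemma isPositive_map (π : Obs d →⋆ₐ[ℂ] (E →L[ℂ] E)) {A : Obs d}
    (hA : (A : CfgSpace d →L[ℂ] CfgSpace d).IsPositive) : (π A).IsPositive := by
  obtain ⟨B, rfl⟩ := exists_star_mul_self hA
  rw [map_mul, map_star, ← ContinuousLinearMap.nonneg_iff_isPositive]
  exact star_mul_self_nonneg _

lemma apply_eq_zero_of_inner_eq_zero {T : E →L[ℂ] E} (hT : T.IsPositive) {v : E}
    (hv : ⟪v, T v⟫_ℂ = 0) : T v = 0 := by
  obtain ⟨B, rfl⟩ := CStarAlgebra.nonneg_iff_eq_star_mul_self.1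
    ((ContinuousLinearMap.nonneg_iff_isPositive _).2 hT)
  rw [ContinuousLinearMap.star_eq_adjoint, mul_apply_eq_comp,
    ContinuousLinearMap.adjoint_inner_right, inner_self_eq_zero] at hv
  rw [mul_apply_eq_comp, hv, map_zero]

lemma map_norm_le (π : Obs d →⋆ₐ[ℂ] (E →L[ℂ] E)) (A : Obs d) : ‖π A‖ ≤ ‖A‖ :=
  NonUnitalStarAlgHom.norm_apply_le π A

/-- A positive operator with spectrum in `{0} ∪ [g, ∞)` is bounded below by `g` on the orthogonal
complement of its kernel. -/
lemma gap_le_inner {T : E →L[ℂ] E} (hT : T.IsPositive) {g : ℝ}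
    (hg : spectrum ℝ T ⊆ {0} ∪ Set.Ici g) {w : E} (hw : w ∈ T.kerᗮ) :
    g * ‖w‖ ^ 2 ≤ (⟪w, T w⟫_ℂ).re := by
  have hsa : IsSelfAdjoint T := hT.isSelfAdjoint
  have hsa' : ContinuousLinearMap.adjoint T = T := hsa
  -- On the spectrum `x²(x - g) ≥ 0`. Evaluated at `u` this is the claim for `w = T u`, and the
  -- range of `T` is dense in the complement of the kernel, so no spectral projection is needed.
  have key : 0 ≤ T * T * T - g • (T * T) := by
    have h1 : cfc (fun x : ℝ => x * x * x - g • (x * x)) T = T * T * T - g • (T * T) := by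
      rw [cfc_sub _ _ T, cfc_mul _ _ T, cfc_mul _ _ T, cfc_smul _ _ T, cfc_mul _ _ T,
        cfc_id' ℝ T]
    rw [← h1]
    have h2 : 0 ≤ T := (ContinuousLinearMap.nonneg_iff_isPositive _).2 hT
    refine cfc_nonneg fun x hx => ?_
    have hx0 : 0 ≤ x := spectrum_nonneg_of_nonneg h2 hx
    rcases hg hx with h | h
    · simp [Set.mem_singleton_iff.1 h]
    · have : g ≤ x := h
      rw [smul_eq_mul, mul_comm g, ← mul_sub]
      exact mul_nonneg (mul_nonneg hx0 hx0) (sub_nonneg.2 this)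
  have hrange : ∀ w ∈ (T.range : Set E), g * ‖w‖ ^ 2 ≤ (⟪w, T w⟫_ℂ).re := by
    rintro _ ⟨u, rfl⟩
    have h := ((ContinuousLinearMap.nonneg_iff_isPositive _).1 key).re_inner_nonneg_right u
    have h3 : ∀ v : E, ⟪u, T v⟫_ℂ = ⟪T u, v⟫_ℂ := fun v => (hT.inner_left_eq_inner_right u v).symm
    have h4 : (T * T * T - g • (T * T)) u = T (T (T u)) - g • T (T u) := rfl
    rw [h4, inner_sub_right, h3, inner_smul_right_eq_smul, h3] at h
    simp only [map_sub, RCLike.re_to_complex, Complex.smul_re, smul_eq_mul] at h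
    have h5 : (⟪T u, T u⟫_ℂ).re = ‖T u‖ ^ 2 := inner_self_eq_norm_sq (𝕜 := ℂ) _
    rw [h5] at h
    exact sub_nonneg.1 h
  rw [ContinuousLinearMap.orthogonal_ker, hsa'] at hw
  have hw' : w ∈ closure (T.range : Set E) := hw
  have hcl : IsClosed {w : E | g * ‖w‖ ^ 2 ≤ (⟪w, T w⟫_ℂ).re} := by
    refine isClosed_le ?_ ?_
    · fun_prop
    · exact Complex.continuous_re.comp (by fun_prop)
  exact closure_minimal hrange hcl hw'

/-- An operator that is annihilated from both sides by the kernel projection of `T` is form-bounded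
by `T`, with a constant given by the spectral gap. -/
lemma norm_inner_le_of_gap {T B : E →L[ℂ] E} (hT : T.IsPositive) {g b : ℝ} (hg0 : 0 < g)
    (hg : spectrum ℝ T ⊆ {0} ∪ Set.Ici g) (hB : IsSelfAdjoint B) (hb : ‖B‖ ≤ b)
    (hker : ∀ v ∈ T.ker, B v = 0) (v : E) :
    ‖⟪v, B v⟫_ℂ‖ ≤ b / g * (⟪v, T v⟫_ℂ).re := by
  obtain ⟨y, hy, z, hz, rfl⟩ := T.ker.exists_add_mem_mem_orthogonal v
  have hTy : T y = 0 := hy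
  have hBy : B y = 0 := hker y hy
  have hBs : ∀ x w : E, ⟪B x, w⟫_ℂ = ⟪x, B w⟫_ℂ := fun x w => hB.isSymmetric x w
  -- Both forms see only the component orthogonal to the kernel: symmetry removes the cross terms.
  have e1 : ⟪y + z, B (y + z)⟫_ℂ = ⟪z, B z⟫_ℂ := by
    rw [map_add, hBy, zero_add, inner_add_left, ← hBs y, hBy, inner_zero_left, zero_add]
  have e2 : ⟪y + z, T (y + z)⟫_ℂ = ⟪z, T z⟫_ℂ := by
    rw [map_add, hTy, zero_add, inner_add_left, ← hT.inner_left_eq_inner_right y, hTy,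
      inner_zero_left, zero_add]
  rw [e1, e2]
  have hb0 : 0 ≤ b := (norm_nonneg _).trans hb
  calc ‖⟪z, B z⟫_ℂ‖ ≤ ‖z‖ * ‖B z‖ := norm_inner_le_norm _ _
    _ ≤ ‖z‖ * (b * ‖z‖) := by
        gcongr
        exact B.le_of_opNorm_le hb z
    _ = b / g * (g * ‖z‖ ^ 2) := by field_simp
    _ ≤ _ := by
        gcongr
        exact gap_le_inner hT hg hz

end Positivity

/-! ### Finite-volume facts -/

section FiniteVolume

variable {Γ : Type*} {d : Γ → ℕ+}

lemma coe_sum_obs {ι : Type*} (s : Finset ι) (A : ι → Obs d) :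
    ((∑ i ∈ s, A i : Obs d) : CfgSpace d →L[ℂ] CfgSpace d)
      = ∑ i ∈ s, (A i : CfgSpace d →L[ℂ] CfgSpace d) :=
  map_sum (quasiLocal d).subtype _ _

lemma isPositive_sum {E ι : Type*} [NormedAddCommGroup E] [InnerProductSpace ℂ E]
    {s : Finset ι} {T : ι → E →L[ℂ] E} (hT : ∀ i ∈ s, (T i).IsPositive) :
    (∑ i ∈ s, T i).IsPositive := by
  classical
  induction s using Finset.induction_on with
  | empty => simp
  | insert i s hi ih =>
    rw [Finset.sum_insert hi]
    exact (hT i (Finset.mem_insert_self i s)).add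
      (ih fun j hj => hT j (Finset.mem_insert_of_mem hj))

variable [MetricSpace Γ] {κ ν R : ℝ} {h : Γ → Obs d}

lemma IsRegularSpace.finite_closedBall (hΓ : IsRegularSpace Γ κ ν) (x : Γ) (r : ℝ) :
    (Metric.closedBall x r).Finite := by
  refine (hΓ x (⌈r⌉₊ + 1) (Nat.le_add_left _ _)).1.subset (Metric.closedBall_subset_closedBall ?_)
  exact (Nat.le_ceil r).trans (by exact_mod_cast Nat.le_succ _)

lemma mem_ball (hΓ : IsRegularSpace Γ κ ν) {x y : Γ} {r : ℝ} : y ∈ ball x r ↔ dist y x ≤ r := by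
  simp [ball, hΓ.finite_closedBall x r]

lemma IsRegularSpace.exists_card_ball_le (hΓ : IsRegularSpace Γ κ ν) (r : ℝ) :
    ∃ K : ℕ, 0 < K ∧ ∀ x : Γ, (ball x r).card ≤ K := by
  set n : ℕ := ⌈r⌉₊ + 1
  refine ⟨⌈κ * (n : ℝ) ^ ν⌉₊ + 1, Nat.succ_pos _, fun x => ?_⟩
  obtain ⟨hf, hc⟩ := hΓ x n (Nat.le_add_left _ _)
  have h1 : (ball x r : Set Γ) ⊆ Metric.closedBall x (n : ℝ) := by
    intro y hy
    have := (mem_ball hΓ).1 (Finset.mem_coe.1 hy)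
    exact this.trans ((Nat.le_ceil r).trans (by exact_mod_cast Nat.le_succ _))
  have h2 : (ball x r).card ≤ (Metric.closedBall x (n : ℝ)).ncard := by
    rw [← Set.ncard_coe_finset]
    exact Set.ncard_le_ncard h1 hf
  have h3 : (Metric.closedBall x (n : ℝ)).ncard ≤ ⌈κ * (n : ℝ) ^ ν⌉₊ := by
    exact_mod_cast hc.trans (Nat.le_ceil _)
  exact h2.trans (h3.trans (Nat.le_succ _))

lemma disjoint_ball_of_notMem_thicken (hΓ : IsRegularSpace Γ κ ν) {Λ : Finset Γ} {x : Γ} {r : ℝ}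
    (hx : x ∉ thicken Λ r) : Disjoint (ball x r) Λ := by
  classical
  rw [Finset.disjoint_left]
  intro y hy hyΛ
  refine hx (Finset.mem_biUnion.2 ⟨y, hyΛ, ?_⟩)
  rw [mem_ball hΓ, dist_comm]
  exact (mem_ball hΓ).1 hy

lemma IsFrustrationFree.isPositive_localHam (hh : IsFrustrationFree R h) (Λ : Finset Γ) :
    (localHam h Λ : CfgSpace d →L[ℂ] CfgSpace d).IsPositive := by
  rw [localHam, coe_sum_obs]
  exact isPositive_sum fun x _ => hh.nonneg x

/-- The expectations of the terms are nonnegative and sum to zero, so each vanishes. A positive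
operator with vanishing expectation in `v` annihilates `v`. -/
lemma IsFrustrationFree.apply_eq_zero (hh : IsFrustrationFree R h) {Λ : Finset Γ}
    {v : CfgSpace d} (hv : (localHam h Λ : CfgSpace d →L[ℂ] CfgSpace d) v = 0) {x : Γ}
    (hx : x ∈ Λ) (hxΛ : h x ∈ localAlg d Λ) : (h x : CfgSpace d →L[ℂ] CfgSpace d) v = 0 := by
  classical
  refine apply_eq_zero_of_inner_eq_zero (hh.nonneg x) ?_
  have h1 : ∑ y ∈ Λ with h y ∈ localAlg d Λ, ⟪v, (h y : CfgSpace d →L[ℂ] CfgSpace d) v⟫_ℂ = 0 := by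
    rw [← inner_sum, ← sum_apply, ← coe_sum_obs]
    convert inner_zero_right v
    convert hv
    rw [localHam]
  exact (Finset.sum_eq_zero_iff_of_nonneg
    fun y _ => (hh.nonneg y).inner_nonneg_right v).1 h1 x (by simp [hx, hxΛ])

/-- Ground states of a volume are ground states of every smaller volume. -/
lemma IsFrustrationFree.ker_localHam_mono (hh : IsFrustrationFree R h) {Λ Λ' : Finset Γ}
    (hs : Λ ⊆ Λ') {v : CfgSpace d}
    (hv : (localHam h Λ' : CfgSpace d →L[ℂ] CfgSpace d) v = 0) :
    (localHam h Λ : CfgSpace d →L[ℂ] CfgSpace d) v = 0 := by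
  classical
  rw [localHam, coe_sum_obs, sum_apply]
  refine Finset.sum_eq_zero fun x hx => ?_
  obtain ⟨hx1, hx2⟩ := Finset.mem_filter.1 hx
  exact hh.apply_eq_zero hv (hs hx1) (localAlg_mono hs hx2)

/-- An observable annihilated by the ground state projection of a smaller volume is form-bounded,
in every representation, by the Hamiltonian of a volume with a spectral gap. -/
lemma IsFrustrationFree.norm_inner_le_of_annihilates (hh : IsFrustrationFree R h)
    {Λ Λ' : Finset Γ} (hs : Λ ⊆ Λ') {g b : ℝ} (hg0 : 0 < g)
    (hg : spectrum ℝ (localHam h Λ') ⊆ {0} ∪ Set.Ici g) {B : Obs d} (hB : IsSelfAdjoint B)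
    (hb : ‖B‖ ≤ b) (hann : (B : CfgSpace d →L[ℂ] CfgSpace d) * groundProj h Λ = 0)
    {E : Type*} [NormedAddCommGroup E] [InnerProductSpace ℂ E] [CompleteSpace E]
    (π : Obs d →⋆ₐ[ℂ] (E →L[ℂ] E)) (ψ : E) :
    ‖⟪ψ, π B ψ⟫_ℂ‖ ≤ b / g * (⟪ψ, π (localHam h Λ') ψ⟫_ℂ).re := by
  have hker : ∀ v ∈ (localHam h Λ' : CfgSpace d →L[ℂ] CfgSpace d).ker,
      (B : CfgSpace d →L[ℂ] CfgSpace d) v = 0 := by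
    intro v hv
    have h1 : v ∈ (localHam h Λ : CfgSpace d →L[ℂ] CfgSpace d).ker := hh.ker_localHam_mono hs hv
    have h2 : groundProj h Λ v = v := Submodule.starProjection_eq_self_iff.2 h1
    have h3 := congrArg (fun T : CfgSpace d →L[ℂ] CfgSpace d => T v) hann
    simpa [h2] using h3
  have hT := hh.isPositive_localHam Λ'
  have hbound := norm_inner_le_of_gap hT hg0 (spectrum_coe (localHam h Λ') ▸ hg)
    (isSelfAdjoint_coe.2 hB) hb hker
  have hsa : ∀ (T : Obs d), IsSelfAdjoint T → ∀ φ : E, (⟪φ, π T φ⟫_ℂ).im = 0 := fun T hT' φ =>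
    (hT'.map π).isSymmetric.im_inner_self_apply φ
  -- The kernel projection acts on `CfgSpace d` only, so the gap bound is recast as positivity of
  -- `±B + (b/g) H` within the algebra, a property that `π` preserves.
  have hpos : ∀ z : ℝ, |z| = 1 → 0 ≤ z * (⟪ψ, π B ψ⟫_ℂ).re
      + b / g * (⟪ψ, π (localHam h Λ') ψ⟫_ℂ).re := by
    intro z hz
    have hz' : IsSelfAdjoint (z : ℂ) := Complex.conj_ofReal z
    have hbg : IsSelfAdjoint ((b / g : ℝ) : ℂ) := Complex.conj_ofReal _
    have hP : (((z : ℂ) • B + ((b / g : ℝ) : ℂ) • localHam h Λ' : Obs d) :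
        CfgSpace d →L[ℂ] CfgSpace d).IsPositive := by
      refine ⟨(isSelfAdjoint_coe.2 ((hz'.smul hB).add
        (hbg.smul (isSelfAdjoint_coe.1 hT.isSelfAdjoint)))).isSymmetric, fun v => ?_⟩
      have h1 : (((z : ℂ) • B + ((b / g : ℝ) : ℂ) • localHam h Λ' : Obs d) :
          CfgSpace d →L[ℂ] CfgSpace d) v = (z : ℂ) • (B : CfgSpace d →L[ℂ] CfgSpace d) v
            + ((b / g : ℝ) : ℂ) • (localHam h Λ' : CfgSpace d →L[ℂ] CfgSpace d) v := rfl
      have h2 := (abs_le.1 ((Complex.abs_re_le_norm _).trans (hbound v)))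
      rw [ContinuousLinearMap.reApplyInnerSelf_apply, inner_re_symm, h1, inner_add_right,
        inner_smul_right, inner_smul_right]
      simp only [RCLike.re_to_complex, Complex.add_re, Complex.re_ofReal_mul]
      rcases eq_or_eq_neg_of_abs_eq hz with rfl | rfl <;> linarith
    have h3 := (isPositive_map π hP).re_inner_nonneg_right ψ
    rw [map_add, map_smul, map_smul] at h3
    simpa only [_root_.add_apply, _root_.smul_apply, inner_add_right, inner_smul_right,
      RCLike.re_to_complex, Complex.add_re, Complex.re_ofReal_mul] using h3
  rw [← Complex.re_add_im ⟪ψ, π B ψ⟫_ℂ, hsa B hB]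
  have h1 := hpos 1 (by simp)
  have h2 := hpos (-1) (by simp)
  simp only [Complex.ofReal_zero, zero_mul, add_zero, Complex.norm_real, Real.norm_eq_abs]
  exact abs_le.2 ⟨by linarith, by linarith⟩

end FiniteVolume

/-! ### Bounded functionals on local observables and the dynamics -/

section Dynamics

variable {Γ : Type*} [MetricSpace Γ] {d : Γ → ℕ+} {κ ν R : ℝ} {h : Γ → Obs d}
  {τ : ℝ → Obs d ≃⋆ₐ[ℂ] Obs d}

lemma norm_starAlgEquiv {A : Type*} [CStarAlgebra A] (α : A ≃⋆ₐ[ℂ] A) (a : A) : ‖α a‖ = ‖a‖ :=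
  NonUnitalStarAlgHom.norm_map α α.injective a

lemma norm_commutator_le {A : Type*} [NormedRing A] {a b : A} {M : ℝ} (ha : ‖a‖ ≤ M) :
    ‖a * b - b * a‖ ≤ 2 * M * ‖b‖ := by
  calc ‖a * b - b * a‖ ≤ ‖a‖ * ‖b‖ + ‖b‖ * ‖a‖ :=
        (norm_sub_le _ _).trans (add_le_add (norm_mul_le _ _) (norm_mul_le _ _))
    _ = 2 * ‖a‖ * ‖b‖ := by ring
    _ ≤ _ := by gcongr

/-- Iterating the derivation `δ₀` on a local observable, every step enlarges the support only by
one ball; the resulting factorial growth is compensated by the iterated integrals. -/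
lemma norm_le_of_hasDerivAt_commutators (hh : IsFrustrationFree R h) {M : ℝ} (hM : ∀ x, ‖h x‖ ≤ M) (hM0 : 0 ≤ M) {K : ℕ}
    (hK : ∀ x : Γ, (ball x R).card ≤ K) {g : Obs d → ℝ → ℂ}
    (hg : ∀ Λ : Finset Γ, ∀ A ∈ localAlg d Λ, ∀ t : ℝ,
      HasDerivAt (g A) (Complex.I * ∑ x ∈ thicken Λ R, g (h x * A - A * h x) t) t)
    {s B : ℝ} (hB0 : 0 ≤ B) (hs : ∀ Λ : Finset Γ, ∀ A ∈ localAlg d Λ, g A s = 0)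
    (hB : ∀ A, ∀ t ∈ Set.Icc s (s + 1), ‖g A t‖ ≤ B * ‖A‖) (k : ℕ) :
    ∀ (p : ℕ) (Λ : Finset Γ), Λ.card ≤ p * K → ∀ A ∈ localAlg d Λ, ∀ t ∈ Set.Icc s (s + 1),
      ‖g A t‖ ≤ B * ‖A‖ * (2 * M * K * K) ^ k * (p + k).choose k * (t - s) ^ k := by
  classical
  induction k with
  | zero =>
    intro p Λ _ A _ t ht
    simpa using hB A t ht
  | succ k ih =>
    -- `p` counts balls: there are at most `p K²` commutators, each of norm at most `2M‖A‖` and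
    -- supported on `p + 1` balls. Iterated integration gives `p(p+1)⋯(p+k-1)/k!`, which the
    -- binomial coefficient dominates.
    intro p Λ hΛ A hA
    set C : ℝ := B * ‖A‖ * (2 * M * K * K) ^ (k + 1) * (p + (k + 1)).choose (k + 1)
    have hthick : ((thicken Λ R).card : ℝ) ≤ p * K * K := by
      have h1 : (thicken Λ R).card ≤ Λ.card * K :=
        Finset.card_biUnion_le_card_mul _ _ _ fun x _ => hK x
      exact_mod_cast h1.trans (Nat.mul_le_mul_right K hΛ)
    refine image_norm_le_of_norm_deriv_right_le_deriv_boundary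
      (f := g A) (f' := fun t => Complex.I * ∑ x ∈ thicken Λ R, g (h x * A - A * h x) t)
      (B' := fun t => C * ((k + 1 : ℕ) * (t - s) ^ k))
      (fun t _ => (hg Λ A hA t).continuousAt.continuousWithinAt)
      (fun t _ => (hg Λ A hA t).hasDerivWithinAt) ?_ ?_ ?_
    · rw [hs Λ A hA]
      simp
    · intro t
      simpa using (((hasDerivAt_id t).sub_const s).pow (k + 1)).const_mul C
    · intro t ht
      have ht0 : 0 ≤ t - s := sub_nonneg.2 ht.1
      have hterm : ∀ x ∈ thicken Λ R, ‖g (h x * A - A * h x) t‖ ≤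
          B * (2 * M * ‖A‖) * (2 * M * K * K) ^ k * (p + 1 + k).choose k * (t - s) ^ k := by
        intro x _
        have hmem : h x * A - A * h x ∈ localAlg d (Λ ∪ ball x R) := by
          have h1 := localAlg_mono (Finset.subset_union_left (s₂ := ball x R)) hA
          have h2 := localAlg_mono (Finset.subset_union_right (s₁ := Λ)) (hh.range x)
          exact sub_mem (mul_mem h2 h1) (mul_mem h1 h2)
        have hcard : (Λ ∪ ball x R).card ≤ (p + 1) * K := by
          refine (Finset.card_union_le _ _).trans ?_
          rw [add_mul, one_mul]
          exact add_le_add hΛ (hK x)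
        refine (ih (p + 1) _ hcard _ hmem t (Set.Ico_subset_Icc_self ht)).trans ?_
        gcongr
        exact norm_commutator_le (hM x)
      rw [norm_mul, Complex.norm_I, one_mul]
      -- The right side equals `(p + 1) * (p + 1 + k).choose k`.
      have hchoose : (p : ℝ) * (p + 1 + k).choose k
          ≤ (p + (k + 1)).choose (k + 1) * ((k + 1 : ℕ) : ℝ) := by
        have h1 := Nat.choose_succ_right_eq (p + (k + 1)) k
        have h2 : p + (k + 1) - k = p + 1 := by omega
        have h3 : p + 1 + k = p + (k + 1) := by omega
        rw [h2] at h1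
        rw [h3]
        have h4 : p * (p + (k + 1)).choose k ≤ (p + (k + 1)).choose (k + 1) * (k + 1) := by
          rw [h1, mul_comm]
          exact Nat.mul_le_mul_left _ (Nat.le_succ p)
        exact_mod_cast h4
      calc ‖∑ x ∈ thicken Λ R, g (h x * A - A * h x) t‖
          ≤ (thicken Λ R).card • (B * (2 * M * ‖A‖) * (2 * M * K * K) ^ k
              * (p + 1 + k).choose k * (t - s) ^ k) :=
            (norm_sum_le _ _).trans (Finset.sum_le_card_nsmul _ _ _ hterm)
        _ ≤ (p * K * K) * (B * (2 * M * ‖A‖) * (2 * M * K * K) ^ k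
              * (p + 1 + k).choose k * (t - s) ^ k) := by
            rw [nsmul_eq_mul]
            gcongr
        _ = B * ‖A‖ * (2 * M * K * K) ^ (k + 1) * (t - s) ^ k
              * (p * (p + 1 + k).choose k) := by ring
        _ ≤ B * ‖A‖ * (2 * M * K * K) ^ (k + 1) * (t - s) ^ k
              * ((p + (k + 1)).choose (k + 1) * ((k + 1 : ℕ) : ℝ)) := by gcongr
        _ = _ := by ring

/-- A bounded functional that is an eigenvector, on local observables, of the transpose of `δ₀`
with eigenvalue `-i` vanishes on local observables. -/
lemma IsDynamics.apply_eq_zero (hτ : IsDynamics R h τ) (hΓ : IsRegularSpace Γ κ ν)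
    (hh : IsFrustrationFree R h) (f : Obs d →L[ℂ] ℂ)
    (hf : ∀ Λ : Finset Γ, ∀ A ∈ localAlg d Λ, f (deriv₀ R h Λ A) = -Complex.I * f A)
    {Λ : Finset Γ} {A : Obs d} (hA : A ∈ localAlg d Λ) : f A = 0 := by
  obtain ⟨K, hK0, hK⟩ := hΓ.exists_card_ball_le R
  obtain ⟨M', hM'⟩ := hh.bounded
  set M := max M' 0
  have hM : ∀ x, ‖h x‖ ≤ M := fun x => (hM' ⟨x, rfl⟩).trans (le_max_left _ _)
  have hM0 : 0 ≤ M := le_max_right _ _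
  -- The defect from the growth law `f(τ_t A) = e^t f(A)`. On local observables these defects
  -- satisfy a closed linear system with zero initial data.
  set g : Obs d → ℝ → ℂ := fun A t => f (τ t A) - (Real.exp t : ℂ) * f A
  have hg : ∀ Λ : Finset Γ, ∀ A ∈ localAlg d Λ, ∀ t : ℝ,
      HasDerivAt (g A) (Complex.I * ∑ x ∈ thicken Λ R, g (h x * A - A * h x) t) t := by
    intro Λ A hA t
    have h1 : HasDerivAt (fun t => f (τ t A)) (f (Complex.I • τ t (deriv₀ R h Λ A))) t :=
      (f.restrictScalars ℝ).hasFDerivAt.comp_hasDerivAt t (hτ.hasDerivAt Λ A hA t)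
    have h2 : HasDerivAt (fun t : ℝ => (Real.exp t : ℂ) * f A) ((Real.exp t : ℂ) * f A) t :=
      (Real.hasDerivAt_exp t).ofReal_comp.mul_const (f A)
    refine (h1.sub h2).congr_deriv ?_
    have h3 : f A = Complex.I * f (deriv₀ R h Λ A) := by
      rw [hf Λ A hA, ← mul_assoc]
      simp
    rw [h3]
    have h4 : ∑ x ∈ thicken Λ R, g (h x * A - A * h x) t = g (deriv₀ R h Λ A) t := by
      change _ = f (τ t (∑ x ∈ thicken Λ R, _)) - _ * f (∑ x ∈ thicken Λ R, _)
      simp only [map_sum, Finset.mul_sum, ← Finset.sum_sub_distrib, g]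
    rw [h4, map_smul, smul_eq_mul]
    ring
  have hgB : ∀ (s : ℝ) (A : Obs d), ∀ t ∈ Set.Icc s (s + 1),
      ‖g A t‖ ≤ ‖f‖ * (1 + Real.exp (s + 1)) * ‖A‖ := by
    intro s A t ht
    calc ‖g A t‖ ≤ ‖f (τ t A)‖ + ‖(Real.exp t : ℂ) * f A‖ := norm_sub_le _ _
      _ ≤ ‖f‖ * ‖A‖ + Real.exp (s + 1) * (‖f‖ * ‖A‖) := by
          rw [norm_mul, Complex.norm_real, Real.norm_of_nonneg (Real.exp_pos t).le]
          gcongr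
          · exact (f.le_opNorm _).trans_eq (by rw [norm_starAlgEquiv])
          · exact ht.2
          · exact f.le_opNorm _
      _ = _ := by ring
  set L : ℝ := 2 * M * K * K
  have hL : 0 ≤ L := by positivity
  -- Small enough that `2 L t₀ < 1`, the factor 2 coming from bounding the binomial coefficient by
  -- `2 ^ (p + k)`. It depends on neither the observable nor the starting time, so the step can be
  -- repeated indefinitely.
  set t₀ : ℝ := 1 / (4 * (L + 1))
  have ht₀ : 0 < t₀ := by positivity
  have ht₀1 : t₀ ≤ 1 := by
    rw [div_le_one (by positivity)]
    linarith
  have hLt : 2 * L * t₀ < 1 := by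
    rw [mul_one_div, div_lt_one (by positivity)]
    linarith
  have hstep : ∀ s : ℝ, (∀ Λ : Finset Γ, ∀ A ∈ localAlg d Λ, g A s = 0) →
      ∀ Λ : Finset Γ, ∀ A ∈ localAlg d Λ, g A (s + t₀) = 0 := by
    intro s hs Λ A hA
    set B : ℝ := ‖f‖ * (1 + Real.exp (s + 1))
    have hB0 : 0 ≤ B := by positivity
    set p := Λ.card
    have hb : ∀ k : ℕ, ‖g A (s + t₀)‖ ≤ B * ‖A‖ * 2 ^ p * (2 * L * t₀) ^ k := by
      intro k
      have h1 := norm_le_of_hasDerivAt_commutators hh hM hM0 hK hg hB0 hs (hgB s) k p Λ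
        (Nat.le_mul_of_pos_right _ hK0) A hA (s + t₀) ⟨by linarith, by linarith⟩
      have h2 : ((p + k).choose k : ℝ) ≤ 2 ^ (p + k) := by
        exact_mod_cast Nat.choose_le_two_pow _ _
      calc ‖g A (s + t₀)‖ ≤ B * ‖A‖ * L ^ k * (p + k).choose k * (s + t₀ - s) ^ k := h1
        _ = B * ‖A‖ * L ^ k * t₀ ^ k * (p + k).choose k := by ring
        _ ≤ B * ‖A‖ * L ^ k * t₀ ^ k * 2 ^ (p + k) := by gcongr
        _ = _ := by clear_value L; rw [mul_pow, mul_pow, pow_add]; ring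
    have hlim := (tendsto_pow_atTop_nhds_zero_of_lt_one (by positivity) hLt).const_mul
      (B * ‖A‖ * 2 ^ p)
    rw [mul_zero] at hlim
    exact norm_le_zero_iff.1 (ge_of_tendsto' hlim hb)
  have hzero : ∀ n : ℕ, ∀ Λ : Finset Γ, ∀ A ∈ localAlg d Λ, g A (n * t₀) = 0 := by
    intro n
    induction n with
    | zero =>
      intro Λ A _
      simp [g, hτ.map_zero]
    | succ n ih =>
      have := hstep _ ih
      rwa [show (n : ℝ) * t₀ + t₀ = ((n + 1 : ℕ) : ℝ) * t₀ by push_cast; ring] at this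
  -- At the times `n t₀` the growth law holds, while automorphisms are isometric and keep `f(τ_t A)`
  -- bounded.
  by_contra hne
  have hpos : 0 < ‖f A‖ := norm_pos_iff.2 hne
  have hle : ∀ n : ℕ, Real.exp (n * t₀) * ‖f A‖ ≤ ‖f‖ * ‖A‖ := by
    intro n
    have h1 : f (τ (n * t₀) A) = (Real.exp (n * t₀) : ℂ) * f A := sub_eq_zero.1 (hzero n Λ A hA)
    have h2 := f.le_opNorm (τ (n * t₀) A)
    rwa [h1, norm_mul, Complex.norm_real, Real.norm_of_nonneg (Real.exp_pos _).le,
      norm_starAlgEquiv] at h2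
  have hlim : Filter.Tendsto (fun n : ℕ => Real.exp (n * t₀) * ‖f A‖) Filter.atTop
      Filter.atTop :=
    (Real.tendsto_exp_atTop.comp
      (tendsto_natCast_atTop_atTop.atTop_mul_const ht₀)).atTop_mul_const hpos
  obtain ⟨n, hn⟩ := (hlim.eventually_gt_atTop (‖f‖ * ‖A‖)).exists
  exact absurd (hle n) (not_le.2 hn)

end Dynamics

/-! ### Generalities on the GNS representation -/

section GNS

/-- The operator `H + i` on the domain of `H`. -/
def addI {E : Type*} [NormedAddCommGroup E] [InnerProductSpace ℂ E] (H : E →ₗ.[ℂ] E) : H.domain →ₗ[ℂ] E := H.toFun + Complex.I • H.domain.subtype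

lemma addI_apply {E : Type*} [NormedAddCommGroup E] [InnerProductSpace ℂ E] (H : E →ₗ.[ℂ] E) (ψ : H.domain) : addI H ψ = H ψ + Complex.I • (ψ : E) := rfl

variable {Γ : Type*} {d : Γ → ℕ+}
  {τ : ℝ → Obs d ≃⋆ₐ[ℂ] Obs d}
  {E : Type*} [NormedAddCommGroup E] [InnerProductSpace ℂ E] [CompleteSpace E]
  {π : Obs d →⋆ₐ[ℂ] (E →L[ℂ] E)} {Ω : E} {H₀ : E →ₗ.[ℂ] E}

/-- The map `A ↦ π(A) Ω` as a bounded operator. -/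
def orbitMap (π : Obs d →⋆ₐ[ℂ] (E →L[ℂ] E)) (Ω : E) : Obs d →L[ℂ] E :=
  LinearMap.mkContinuous
    { toFun := fun A => π A Ω
      map_add' := fun A B => by simp
      map_smul' := fun z A => by rw [map_smul]; rfl } ‖Ω‖
    (fun A => by
      rw [mul_comm]
      exact (π A).le_of_opNorm_le (map_norm_le π A) Ω)

lemma orbitMap_apply (A : Obs d) : orbitMap π Ω A = π A Ω := rfl

/-- The zero derivative at time `0` is carried to time `s` by `U t = U s * U (t - s)`. -/
lemma IsExpGroup.apply_eq_of_graph_zero {U : ℝ → E →L[ℂ] E} (hU : IsExpGroup H₀ U)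
    (hΩ : (Ω, (0 : E)) ∈ H₀.graph) (t : ℝ) : U t Ω = Ω := by
  have h0 : HasDerivAt (fun t => U t Ω) 0 0 := by
    simpa using (hU.generator Ω 0).1 hΩ
  have hd : ∀ s : ℝ, HasDerivAt (fun t => U t Ω) 0 s := by
    intro s
    have h1 : HasDerivAt (fun t => U (t - s) Ω) 0 s := by
      refine HasDerivAt.comp_sub_const (f := fun t => U t Ω) s s ?_
      rwa [sub_self]
    have h2 : HasDerivAt (fun t => U s (U (t - s) Ω)) (U s 0) s :=
      ((U s).restrictScalars ℝ).hasFDerivAt.comp_hasDerivAt s h1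
    rw [_root_.map_zero] at h2
    convert h2 using 2 with t
    rw [← mul_apply_eq_comp, ← hU.map_add, add_sub_cancel]
  have := is_const_of_deriv_eq_zero (f := fun t => U t Ω) (fun s => (hd s).differentiableAt) (fun s => (hd s).deriv) t 0
  simpa [hU.map_zero] using this

/-- The cross term vanishes because `⟪H₀ ψ, ψ⟫` is real. Thus `H₀ + i` is an isometry for the graph
norm, and density of the image of a subspace makes that subspace a core. -/
lemma IsGNSHamiltonian.norm_sq_addI (hH₀ : IsGNSHamiltonian τ π Ω H₀) (ψ : H₀.domain) :
    ‖addI H₀ ψ‖ ^ 2 = ‖H₀ ψ‖ ^ 2 + ‖(ψ : E)‖ ^ 2 := by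
  have h1 : (⟪H₀ ψ, (ψ : E)⟫_ℂ).im = 0 := by
    rw [← inner_conj_symm, Complex.conj_im, ← (Complex.nonneg_iff.1 (hH₀.nonneg ψ)).2, neg_zero]
  rw [addI_apply, @norm_add_sq ℂ, inner_smul_right, norm_smul, Complex.norm_I, one_mul]
  simp [h1]

end GNS

/-! ### The GNS Hamiltonian on local vectors -/

section LocalVectors

variable {Γ : Type*} [MetricSpace Γ] {d : Γ → ℕ+} {κ ν R : ℝ} {h : Γ → Obs d}
  {τ : ℝ → Obs d ≃⋆ₐ[ℂ] Obs d} {ω : Obs d →ₗ[ℂ] ℂ}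
  {E : Type*} [NormedAddCommGroup E] [InnerProductSpace ℂ E] [CompleteSpace E]
  {π : Obs d →⋆ₐ[ℂ] (E →L[ℂ] E)} {Ω : E} {H₀ : E →ₗ.[ℂ] E}

lemma map_apply_vacuum_eq_zero (hh : IsFrustrationFree R h) (hω : IsZeroEnergyState h ω)
    (hπ : IsGNSTriple ω π Ω) (x : Γ) : π (h x) Ω = 0 :=
  apply_eq_zero_of_inner_eq_zero (isPositive_map π (hh.nonneg x))
    (by rw [← hπ.apply_eq, hω.zero_energy])

/-- Since `U (-t)` fixes `Ω`, the orbit `U t (π A Ω)` equals `π (τ t A) Ω`, whose derivative at `0`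
is known for local `A`. -/
lemma IsGNSHamiltonian.mem_graph (hH₀ : IsGNSHamiltonian τ π Ω H₀) (hτ : IsDynamics R h τ)
    {Λ : Finset Γ} {A : Obs d} (hA : A ∈ localAlg d Λ) :
    (π A Ω, π (deriv₀ R h Λ A) Ω) ∈ H₀.graph := by
  obtain ⟨U, hU, hUτ⟩ := hH₀.implements
  rw [hU.generator]
  have h1 : HasDerivAt (fun t => orbitMap π Ω (τ t A))
      (orbitMap π Ω (Complex.I • τ 0 (deriv₀ R h Λ A))) 0 :=
    ((orbitMap π Ω).restrictScalars ℝ).hasFDerivAt.comp_hasDerivAt 0 (hτ.hasDerivAt Λ A hA 0)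
  rw [map_smul, hτ.map_zero, orbitMap_apply] at h1
  convert h1 using 2 with t
  rw [orbitMap_apply, hUτ, mul_apply_eq_comp, mul_apply_eq_comp,
    hU.apply_eq_of_graph_zero hH₀.vacuum]

lemma map_deriv₀_apply_vacuum (hh : IsFrustrationFree R h) (hω : IsZeroEnergyState h ω)
    (hπ : IsGNSTriple ω π Ω) (Λ : Finset Γ) (A : Obs d) :
    π (deriv₀ R h Λ A) Ω = ∑ x ∈ thicken Λ R, π (h x) (π A Ω) := by
  rw [deriv₀, map_sum, sum_apply]
  refine Finset.sum_congr rfl fun x _ => ?_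
  rw [map_sub, map_mul, map_mul, _root_.sub_apply, mul_apply_eq_comp, mul_apply_eq_comp,
    map_apply_vacuum_eq_zero hh hω hπ, map_zero, sub_zero]

/-- For `x` outside `Λ(R)`, `h x` commutes with `A` and annihilates the vacuum, so the right side
already contains every nonzero term and `Y` may be arbitrary. -/
lemma re_inner_sum_le_of_local (hΓ : IsRegularSpace Γ κ ν) (hh : IsFrustrationFree R h)
    (hω : IsZeroEnergyState h ω) (hπ : IsGNSTriple ω π Ω) {Λ : Finset Γ} {A : Obs d}
    (hA : A ∈ localAlg d Λ) (Y : Finset Γ) :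
    ∑ x ∈ Y, (⟪π A Ω, π (h x) (π A Ω)⟫_ℂ).re ≤ (⟪π A Ω, π (deriv₀ R h Λ A) Ω⟫_ℂ).re := by
  classical
  rw [map_deriv₀_apply_vacuum hh hω hπ, inner_sum, Complex.re_sum]
  have hnn : ∀ x, 0 ≤ (⟪π A Ω, π (h x) (π A Ω)⟫_ℂ).re := fun x =>
    (isPositive_map π (hh.nonneg x)).re_inner_nonneg_right _
  have hzero : ∀ x, x ∉ thicken Λ R → (⟪π A Ω, π (h x) (π A Ω)⟫_ℂ).re = 0 := by
    intro x hx
    have h1 := localAlg_commute (disjoint_ball_of_notMem_thicken hΓ hx) (hh.range x) hA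
    rw [← mul_apply_eq_comp, ← map_mul, h1, map_mul, mul_apply_eq_comp,
      map_apply_vacuum_eq_zero hh hω hπ, map_zero, inner_zero_right, Complex.zero_re]
  calc ∑ x ∈ Y, (⟪π A Ω, π (h x) (π A Ω)⟫_ℂ).re
      ≤ ∑ x ∈ Y ∪ thicken Λ R, (⟪π A Ω, π (h x) (π A Ω)⟫_ℂ).re :=
        Finset.sum_le_sum_of_subset_of_nonneg Finset.subset_union_left fun x _ _ => hnn x
    _ = _ := (Finset.sum_subset Finset.subset_union_right fun x _ hx => hzero x hx).symm

/-! ### Local vectors are a core -/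

/-- The subspace of local vectors. -/
def localVectors (π : Obs d →⋆ₐ[ℂ] (E →L[ℂ] E)) (Ω : E) : Submodule ℂ E where
  carrier := {ψ | ∃ Λ : Finset Γ, ∃ A ∈ localAlg d Λ, ψ = π A Ω}
  add_mem' := by
    classical
    rintro _ _ ⟨Λ, A, hA, rfl⟩ ⟨Λ', B, hB, rfl⟩
    exact ⟨Λ ∪ Λ', A + B, add_mem (localAlg_mono Finset.subset_union_left hA)
      (localAlg_mono Finset.subset_union_right hB), by simp⟩
  zero_mem' := ⟨∅, 0, zero_mem _, by simp⟩
  smul_mem' := by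
    rintro z _ ⟨Λ, A, hA, rfl⟩
    exact ⟨Λ, z • A, SMulMemClass.smul_mem z hA, by rw [map_smul]; rfl⟩

/-- The range of `H₀ + i` on local vectors is dense. -/
lemma IsGNSHamiltonian.dense_map_addI (hH₀ : IsGNSHamiltonian τ π Ω H₀) (hτ : IsDynamics R h τ)
    (hΓ : IsRegularSpace Γ κ ν) (hh : IsFrustrationFree R h) (hπ : IsGNSTriple ω π Ω) :
    Dense (((localVectors π Ω).comap H₀.domain.subtype).map (addI H₀) : Set E) := by
  rw [Submodule.dense_iff_topologicalClosure_eq_top, Submodule.topologicalClosure_eq_top_iff,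
    Submodule.eq_bot_iff]
  intro η hη
  have hloc : ∀ Λ : Finset Γ, ∀ A ∈ localAlg d Λ, ⟪η, π A Ω⟫_ℂ = 0 := by
    intro Λ A hA
    -- Orthogonality of `η` to `(H₀ + i) π(A)Ω` is exactly the eigenvalue relation for this
    -- functional.
    refine hτ.apply_eq_zero hΓ hh ((innerSL ℂ η).comp (orbitMap π Ω)) ?_ hA
    intro Λ A hA
    obtain ⟨ψ, hψ1, hψ2⟩ := H₀.mem_graph_iff.1 (hH₀.mem_graph hτ hA)
    have h1 := Submodule.inner_left_of_mem_orthogonal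
      (Submodule.mem_map_of_mem (f := addI H₀) (p := (localVectors π Ω).comap H₀.domain.subtype)
        (show ψ ∈ _ from ⟨Λ, A, hA, hψ1⟩)) hη
    rw [addI_apply, hψ1, hψ2, inner_add_right, inner_smul_right] at h1
    change ⟪η, π (deriv₀ R h Λ A) Ω⟫_ℂ = -Complex.I * ⟪η, π A Ω⟫_ℂ
    rw [neg_mul]
    exact eq_neg_of_add_eq_zero_left h1
  refine hπ.dense.eq_zero_of_inner_left ℂ ?_
  rintro _ ⟨Λ, A, hA, rfl⟩
  exact hloc Λ A hA

/-- Local vectors form a core of the GNS Hamiltonian. -/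
lemma IsGNSHamiltonian.exists_seq_local (hH₀ : IsGNSHamiltonian τ π Ω H₀)
    (hτ : IsDynamics R h τ) (hΓ : IsRegularSpace Γ κ ν) (hh : IsFrustrationFree R h)
    (hπ : IsGNSTriple ω π Ω) (ψ : H₀.domain) :
    ∃ φ : ℕ → H₀.domain, (∀ k, (φ k : E) ∈ localVectors π Ω) ∧
      Filter.Tendsto (fun k => (φ k : E)) Filter.atTop (nhds ψ) ∧
      Filter.Tendsto (fun k => H₀ (φ k)) Filter.atTop (nhds (H₀ ψ)) := by
  obtain ⟨u, hu, hlim⟩ := mem_closure_iff_seq_limit.1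
    (hH₀.dense_map_addI hτ hΓ hh hπ (addI H₀ ψ))
  choose φ hφ hφu using hu
  have hlim' : Filter.Tendsto (fun k => ‖addI H₀ (φ k - ψ)‖) Filter.atTop (nhds 0) := by
    have := tendsto_iff_norm_sub_tendsto_zero.1 hlim
    refine this.congr fun k => ?_
    rw [map_sub, hφu]
  refine ⟨φ, hφ, ?_, ?_⟩ <;> rw [tendsto_iff_norm_sub_tendsto_zero] <;>
    refine squeeze_zero (fun _ => norm_nonneg _) (fun k => ?_) hlim' <;>
    refine (sq_le_sq₀ (norm_nonneg _) (norm_nonneg _)).1 ?_ <;>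
    rw [hH₀.norm_sq_addI, H₀.map_sub]
  · rw [Submodule.coe_sub]
    linarith [sq_nonneg ‖H₀ (φ k) - H₀ ψ‖]
  · linarith [sq_nonneg ‖((φ k - ψ : H₀.domain) : E)‖]

/-- Every finite-volume energy is bounded by the GNS Hamiltonian in the sense of forms. -/
lemma IsGNSHamiltonian.re_inner_sum_le (hH₀ : IsGNSHamiltonian τ π Ω H₀)
    (hτ : IsDynamics R h τ) (hΓ : IsRegularSpace Γ κ ν) (hh : IsFrustrationFree R h)
    (hω : IsZeroEnergyState h ω) (hπ : IsGNSTriple ω π Ω) (Y : Finset Γ) (ψ : H₀.domain) :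
    ∑ x ∈ Y, (⟪(ψ : E), π (h x) ψ⟫_ℂ).re ≤ (⟪(ψ : E), H₀ ψ⟫_ℂ).re := by
  obtain ⟨φ, hφ, hlim1, hlim2⟩ := hH₀.exists_seq_local hτ hΓ hh hπ ψ
  refine le_of_tendsto_of_tendsto' (b := Filter.atTop)
    (f := fun k => ∑ x ∈ Y, (⟪(φ k : E), π (h x) (φ k)⟫_ℂ).re)
    (g := fun k => (⟪(φ k : E), H₀ (φ k)⟫_ℂ).re) ?_ ?_ fun k => ?_
  · refine tendsto_finsetSum _ fun x _ => ?_
    exact (Complex.continuous_re.tendsto _).comp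
      (hlim1.inner (((π (h x)).continuous.tendsto _).comp hlim1))
  · exact (Complex.continuous_re.tendsto _).comp (hlim1.inner hlim2)
  · obtain ⟨Λ, A, hA, hφA⟩ := hφ k
    obtain ⟨χ, hχ1, hχ2⟩ := H₀.mem_graph_iff.1 (hH₀.mem_graph hτ hA)
    have hχ : χ = φ k := Subtype.ext (hχ1.trans hφA.symm)
    rw [← hχ, hχ1, hχ2]
    exact re_inner_sum_le_of_local hΓ hh hω hπ hA Y

end LocalVectors

/-! ### Summation over separating partitions -/

section Partitions

variable {Γ : Type*} [MetricSpace Γ] {d : Γ → ℕ+} {κ ν R : ℝ} {h : Γ → Obs d}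
  {τ : ℝ → Obs d ≃⋆ₐ[ℂ] Obs d} {ω : Obs d →ₗ[ℂ] ℂ}
  {E : Type*} [NormedAddCommGroup E] [InnerProductSpace ℂ E] [CompleteSpace E]
  {π : Obs d →⋆ₐ[ℂ] (E →L[ℂ] E)} {Ω : E} {H₀ : E →ₗ.[ℂ] E}
  {S : Γ → ℕ → Finset Γ} {T : ℕ → Set (Set Γ)} {c ζ : ℝ}

lemma IsFrustrationFree.re_inner_localHam_le (hh : IsFrustrationFree R h) (Λ : Finset Γ) (ψ : E) :
    (⟪ψ, π (localHam h Λ) ψ⟫_ℂ).re ≤ ∑ x ∈ Λ, (⟪ψ, π (h x) ψ⟫_ℂ).re := by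
  classical
  rw [localHam, map_sum, sum_apply, inner_sum, Complex.re_sum]
  exact Finset.sum_le_sum_of_subset_of_nonneg (Finset.filter_subset _ _) fun x _ _ =>
    (isPositive_map π (hh.nonneg x)).re_inner_nonneg_right _

/-- Energies of pairwise disjoint volumes add up to at most the total energy. -/
lemma IsGNSHamiltonian.sum_localHam_le (hH₀ : IsGNSHamiltonian τ π Ω H₀)
    (hτ : IsDynamics R h τ) (hΓ : IsRegularSpace Γ κ ν) (hh : IsFrustrationFree R h)
    (hω : IsZeroEnergyState h ω) (hπ : IsGNSTriple ω π Ω) {ι : Type*} (F : Finset ι)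
    (Y : ι → Finset Γ) (hY : (F : Set ι).PairwiseDisjoint Y) (ψ : H₀.domain) :
    ∑ i ∈ F, (⟪(ψ : E), π (localHam h (Y i)) ψ⟫_ℂ).re ≤ (⟪(ψ : E), H₀ ψ⟫_ℂ).re := by
  classical
  refine (Finset.sum_le_sum fun i _ => hh.re_inner_localHam_le (Y i) (ψ : E)).trans ?_
  rw [← Finset.sum_biUnion hY]
  exact hH₀.re_inner_sum_le hτ hΓ hh hω hπ _ ψ

/-- A sum over a finite set is controlled by the sums over its intersections with the parts of a
separating partition. -/
lemma IsSeparatingFamily.sum_le (hST : IsSeparatingFamily S T c ζ) {n : ℕ} (hn : 1 ≤ n)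
    (F : Finset Γ) (a : Γ → ℝ) {q : ℝ} (hq : 0 ≤ q)
    (ha : ∀ F' ⊆ F, (F' : Set Γ).PairwiseDisjoint (fun x => S x n) → ∑ x ∈ F', a x ≤ q) :
    ∑ x ∈ F, a x ≤ c * (n : ℝ) ^ ζ * q := by
  classical
  have hex : ∀ x : Γ, ∃ t ∈ T n, x ∈ t := fun x => ((hST.partition n hn).2 x).exists
  choose t htT htx using hex
  have hmaps : ∀ x ∈ F, t x ∈ (hST.finite n hn).toFinset := fun x _ => by simpa using htT x
  -- Each fibre of `t` lies in a single part, so its volumes are disjoint and it contributes at most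
  -- `q`.
  rw [← Finset.sum_fiberwise_of_maps_to hmaps]
  calc ∑ p ∈ (hST.finite n hn).toFinset, ∑ x ∈ F with t x = p, a x
      ≤ (hST.finite n hn).toFinset.card • q := by
        refine Finset.sum_le_card_nsmul _ _ _ fun p hp => ha _ (Finset.filter_subset _ _) ?_
        intro x hx y hy hxy
        have hx' : t x = p := (Finset.mem_filter.1 (Finset.mem_coe.1 hx)).2
        have hy' : t y = p := (Finset.mem_filter.1 (Finset.mem_coe.1 hy)).2
        exact hST.separates n hn p (by simpa using hp) x (hx' ▸ htx x) y (hy' ▸ htx y) hxy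
    _ = (T n).ncard * q := by rw [nsmul_eq_mul, Set.ncard_eq_toFinset_card _ (hST.finite n hn)]
    _ ≤ _ := by
        gcongr
        exact hST.growth n hn

end Partitions

end QSpin

end

theorem theorem5p1 {Γ : Type*} [MetricSpace Γ] {κ ν : ℝ} (hν : 0 < ν)
    (hΓ : QSpin.IsRegularSpace Γ κ ν) (d : Γ → ℕ+)
    -- the finite-range, uniformly bounded, frustration-free reference model and its dynamics
    {R : ℝ} (hR : 0 < R) (h : Γ → QSpin.Obs d) (hh : QSpin.IsFrustrationFree R h)
    (τ : ℝ → QSpin.Obs d ≃⋆ₐ[ℂ] QSpin.Obs d) (hτ : QSpin.IsDynamics R h τ)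
    -- a zero-energy ground state, its GNS triple and its GNS Hamiltonian
    (ω : QSpin.Obs d →ₗ[ℂ] ℂ) (hω : QSpin.IsZeroEnergyState h ω)
    {E : Type*} [NormedAddCommGroup E] [InnerProductSpace ℂ E] [CompleteSpace E]
    (π : QSpin.Obs d →⋆ₐ[ℂ] (E →L[ℂ] E)) (Ω : E) (hπ : QSpin.IsGNSTriple ω π Ω)
    (H₀ : E →ₗ.[ℂ] E) (hH₀ : QSpin.IsGNSHamiltonian τ π Ω H₀)
    -- separating partitions and local gaps
    (S : Γ → ℕ → Finset Γ) (T : ℕ → Set (Set Γ)) {c ζ : ℝ} (hST : QSpin.IsSeparatingFamily S T c ζ)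
    (γ : ℕ → ℝ) (hγ : ∀ n : ℕ, R ≤ n → 0 < γ n)
    (hgap : ∀ (x : Γ) (n : ℕ), R ≤ n →
      spectrum ℝ (QSpin.localHam h (S x n)) ⊆ {0} ∪ Set.Ici (γ n))
    -- the anchored interaction
    (Φ : Γ → ℕ → QSpin.Obs d)
    (hΦ_sa : ∀ (x : Γ) (n : ℕ), R ≤ n → IsSelfAdjoint (Φ x n))
    (hΦ_loc : ∀ (x : Γ) (n : ℕ), R ≤ n → Φ x n ∈ QSpin.localAlg d (QSpin.ball x n))
    (hΦ_sum : Summable fun p : Γ × {n : ℕ // R ≤ n} => ‖Φ p.1 p.2‖)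
    (hΦ_annih : ∀ (x : Γ) (n : ℕ), R ≤ n →
      (Φ x n : QSpin.CfgSpace d →L[ℂ] QSpin.CfgSpace d) * QSpin.groundProj h (QSpin.ball x n) = 0 ∧
      QSpin.groundProj h (QSpin.ball x n) * (Φ x n : QSpin.CfgSpace d →L[ℂ] QSpin.CfgSpace d) = 0)
    (G : ℕ → ℝ) (hG : ∀ n, 0 ≤ G n) (hΦG : ∀ (x : Γ) (n : ℕ), R ≤ n → ‖Φ x n‖ ≤ G n)
    (V : QSpin.Obs d) (hV : V = ∑' p : Γ × {n : ℕ // R ≤ n}, Φ p.1 p.2)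
    -- `β = c ∑_{n ≥ R} n ^ ζ G(n) / γ(n)`, an element of `[0, ∞]`
    (β : ℝ≥0∞)
    (hβ : β = ENNReal.ofReal c *
      ∑' n : {n : ℕ // R ≤ n}, ENNReal.ofReal (((n : ℕ) : ℝ) ^ ζ * G n / γ n)) :
    ∀ ψ : H₀.domain,
      ENNReal.ofReal ‖⟪(ψ : E), π V ψ⟫_ℂ‖ ≤ β * ENNReal.ofReal (⟪(ψ : E), H₀ ψ⟫_ℂ).re := by
  classical
  intro ψ
  set q : ℝ := (⟪(ψ : E), H₀ ψ⟫_ℂ).re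
  have hq : 0 ≤ q := (Complex.nonneg_iff.1 (hH₀.nonneg ψ)).1
  have hfix : ∀ n : ℕ, R ≤ n → ∀ F : Finset Γ,
      ∑ x ∈ F, ‖⟪(ψ : E), π (Φ x n) ψ⟫_ℂ‖ ≤ c * ((n : ℝ) ^ ζ * G n / γ n) * q := by
    intro n hn F
    have hn1 : 1 ≤ n := by
      have : (0 : ℝ) < n := hR.trans_le hn
      exact_mod_cast this
    have hGγ : 0 ≤ G n / γ n := div_nonneg (hG n) (hγ n hn).le
    refine (hST.sum_le hn1 F _ (mul_nonneg hGγ hq) fun F' _ hF' => ?_).trans_eq (by ring)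
    calc ∑ x ∈ F', ‖⟪(ψ : E), π (Φ x n) ψ⟫_ℂ‖
        ≤ ∑ x ∈ F', G n / γ n * (⟪(ψ : E), π (QSpin.localHam h (S x n)) ψ⟫_ℂ).re :=
          Finset.sum_le_sum fun x _ =>
            hh.norm_inner_le_of_annihilates (hST.ball_subset x n) (hγ n hn) (hgap x n hn)
              (hΦ_sa x n hn) (hΦG x n hn) (hΦ_annih x n hn).1 π ψ
      _ = G n / γ n * ∑ x ∈ F', (⟪(ψ : E), π (QSpin.localHam h (S x n)) ψ⟫_ℂ).re := by
          rw [Finset.mul_sum]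
      _ ≤ G n / γ n * q := by
          gcongr
          exact hH₀.sum_localHam_le hτ hΓ hh hω hπ F' _ hF' ψ
  have hfin : ∀ F : Finset (Γ × {n : ℕ // R ≤ n}),
      ENNReal.ofReal ‖⟪(ψ : E), π (∑ p ∈ F, Φ p.1 p.2) ψ⟫_ℂ‖ ≤ β * ENNReal.ofReal q := by
    intro F
    -- Enlarging `F` to a rectangle lets `hfix` be applied to the sum over sites at each fixed `n`.
    have hsub : F ⊆ F.image Prod.fst ×ˢ F.image Prod.snd := fun p hp =>
      Finset.mem_product.2 ⟨Finset.mem_image_of_mem _ hp, Finset.mem_image_of_mem _ hp⟩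
    have hnn : ∀ n : {n : ℕ // R ≤ n}, 0 ≤ ((n : ℕ) : ℝ) ^ ζ * G n / γ n := fun n =>
      div_nonneg (mul_nonneg (Real.rpow_nonneg (Nat.cast_nonneg _) _) (hG n)) (hγ n n.2).le
    have h1 : ‖⟪(ψ : E), π (∑ p ∈ F, Φ p.1 p.2) ψ⟫_ℂ‖
        ≤ c * (∑ n ∈ F.image Prod.snd, ((n : ℕ) : ℝ) ^ ζ * G n / γ n) * q := by
      rw [map_sum, sum_apply, inner_sum, Finset.mul_sum, Finset.sum_mul]
      calc ‖∑ p ∈ F, ⟪(ψ : E), π (Φ p.1 p.2) ψ⟫_ℂ‖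
          ≤ ∑ p ∈ F, ‖⟪(ψ : E), π (Φ p.1 p.2) ψ⟫_ℂ‖ := norm_sum_le _ _
        _ ≤ ∑ p ∈ F.image Prod.fst ×ˢ F.image Prod.snd, ‖⟪(ψ : E), π (Φ p.1 p.2) ψ⟫_ℂ‖ :=
            Finset.sum_le_sum_of_subset_of_nonneg hsub fun _ _ _ => norm_nonneg _
        _ = ∑ n ∈ F.image Prod.snd, ∑ x ∈ F.image Prod.fst, ‖⟪(ψ : E), π (Φ x n) ψ⟫_ℂ‖ :=
            Finset.sum_product_right _ _ _
        _ ≤ _ := Finset.sum_le_sum fun n _ => hfix n n.2 _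
    -- Only finite sums have been estimated in `ℝ`. Passing to `ℝ≥0∞` here covers `β = ∞` together
    -- with the convention `∞ * 0 = 0`.
    refine (ENNReal.ofReal_le_ofReal h1).trans ?_
    rw [ENNReal.ofReal_mul (mul_nonneg hST.c_pos.le (Finset.sum_nonneg fun n _ => hnn n)),
      ENNReal.ofReal_mul hST.c_pos.le, ENNReal.ofReal_sum_of_nonneg fun n _ => hnn n, hβ]
    gcongr
    exact ENNReal.sum_le_tsum _
  have hsum : HasSum (fun p : Γ × {n : ℕ // R ≤ n} => Φ p.1 p.2) V :=
    hV ▸ hΦ_sum.of_norm.hasSum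
  -- The bound is uniform in `F`, and `A ↦ π(A)ψ` is norm continuous, so it passes to the limit `V`.
  refine le_of_tendsto' (x := Filter.atTop) ((ENNReal.continuous_ofReal.tendsto _).comp
    (Filter.Tendsto.norm ?_)) hfin
  have h1 : Filter.Tendsto (fun F : Finset (Γ × {n : ℕ // R ≤ n}) =>
      QSpin.orbitMap π (ψ : E) (∑ p ∈ F, Φ p.1 p.2)) Filter.atTop
      (nhds (QSpin.orbitMap π (ψ : E) V)) :=
    ((QSpin.orbitMap π (ψ : E)).continuous.tendsto _).comp hsum
  exact tendsto_const_nhds.inner h1
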